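/- For irrational $\alpha\in(0,1)$ let $R_\alpha(x)=x+\alpha \pmod 1$ on $[0,1)$, and let $f(x)=1/x$ for $x\in(0,1)$, with the convention $f(0)=0$. For $N\ge 1$ and $x\in[0,1)$ let $$S_N^1(f)(x)=\sum_{n=0}^{N-1} f(R_\alpha^n x)-\max_{0\le n\le N-1} f(R_\alpha^n x)$$ be the lightly trimmed ergodic sum (one largest term is removed). Then for Lebesgue-almost every $\alpha\in(0,1)$ it holds, both at the point $x=\alpha$ and at the point $x=0$, that $$\limsup_{N\to\infty}\frac{S_N^1(f)(x)}{N\log N}>1\ge\liminf_{N\to\infty}\frac{S_N^1(f)(x)}{N\log N},$$ where the $\limsup$ and $\liminf$ are taken in $[-\infty,\infty]$ (so the $\limsup$ may be $+\infty$). In particular $S_N^1(f)(x)/(N\log N)$ has no limit in $[-\infty,\infty]$ at $x=\alpha$ or $x=0$, so the lightly trimmed strong law fails at these points. -/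

import Mathlib

noncomputable section

/-- The trimmed ergodic sum `S_N^k(f)(x)` of `f` along the `T`-orbit of `x`: the sum of
`f (T^n x)` over `0 ≤ n < N` minus the largest value of the sum of `f (T^j x)` over `k` distinct
indices `j` in `{0, …, N - 1}`; it is `0` by convention if `k > N`. -/
def trimmedSum {X : Type*} (T : X → X) (f : X → ℝ) (N k : ℕ) (x : X) : ℝ :=
  if h : k ≤ N then
    (∑ n ∈ Finset.range N, f (T^[n] x)) -
      ((Finset.range N).powersetCard k).sup'
        (Finset.powersetCard_nonempty.mpr (by simpa using h))
        (fun s => ∑ j ∈ s, f (T^[j] x))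
  else 0

/-- The rotation `R_α (x) = x + α (mod 1)` of the circle, identified with `[0, 1)`. -/
def circleRotation (α : ℝ) (x : ℝ) : ℝ := Int.fract (x + α)

/-- The function `f(x) = 1 / x` on `[0, 1)`, with the convention that `f(0) = 0`: the value `∞` of
a `[0, ∞]`-valued observable is replaced by `0`. -/
def reciprocalObservable (x : ℝ) : ℝ := if x = 0 then 0 else 1 / x

/-- The normalised lightly trimmed sum `S_N^1(f)(x) / (N log N)` for `f(x) = 1 / x` and the rotation
by `α`. -/
def lightlyTrimmedRatio (α x : ℝ) (N : ℕ) : ℝ :=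
  trimmedSum (circleRotation α) reciprocalObservable N 1 x / ((N : ℝ) * Real.log (N : ℝ))

end

open MeasureTheory Filter Topology

/-! Both bounds come from rational approximations of `α` from below. If `q * α - p = δ` is positive
and tiny, the multiples `q * α` and `2 * q * α` have fractional parts `δ` and `2 * δ`. Removing one
term still leaves a value at least `1 / (2 * δ)`, so for `δ` far below `1 / (q * log q)` the trimmed
sum exceeds `N log N` by any prescribed factor at some `N` comparable to the bound on `q`
(`exists_two_le_lightlyTrimmedRatio`). If `p / q` is reduced and `0 < α - p / q < 1 / q ^ 2`, the
points `j * α` with `0 < j < q` lie just to the right of the distinct points `i / q` with `0 < i <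
q`. Their reciprocals then sum to at most `q * (1 + log q)`, and `N = q` bounds the liminf
(`exists_lightlyTrimmedRatio_lt`).

What remains is a one-sided Khinchin theorem: almost every `α` lies in `lowerKhinchinSet`. Intervals
to the right of fractions at dyadic level `k` have total length of order `1 / (n * k)`, a divergent
series. Separation of the fractions controls the overlaps, and a second moment argument gives
measure at least `1 / 256`, uniformly in `n` (`le_measureReal_iUnion_upperGaps`). Ergodicity of
doubling on the circle upgrades positive measure to full measure (`ae_mem_lowerKhinchinSet`). -/

/-! ### Counting and spacing of fractions. -/

/-- The pairs of coprime integers in `[1, Q]²`. -/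
def coprimePairs (Q : ℕ) : Finset (ℕ × ℕ) :=
  (Finset.Ioc 0 Q ×ˢ Finset.Ioc 0 Q).filter fun x => x.1.Coprime x.2

theorem mem_coprimePairs {Q : ℕ} {x : ℕ × ℕ} :
    x ∈ coprimePairs Q ↔ (0 < x.1 ∧ x.1 ≤ Q) ∧ (0 < x.2 ∧ x.2 ≤ Q) ∧ x.1.Coprime x.2 := by
  simp [coprimePairs, and_assoc]

theorem card_coprimePairs_le (Q : ℕ) : (coprimePairs Q).card ≤ Q ^ 2 := by
  refine (Finset.card_filter_le _ _).trans ?_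
  simp [sq]

theorem sum_Ioc_one_div_sq_le (Q : ℕ) :
    ∑ d ∈ Finset.Ioc 1 Q, 1 / (d : ℝ) ^ 2 ≤ 3 / 4 := by
  -- The subtracted tail closes the induction, because `1 / (m + 1) ^ 2 ≤ 1 / m - 1 / (m + 1)`.
  have key : ∀ n : ℕ, ∑ d ∈ Finset.Ioc 1 (n + 2), 1 / (d : ℝ) ^ 2 ≤ 3 / 4 - 1 / (n + 2 : ℝ) := by
    intro n
    induction n with
    | zero => norm_num
    | succ n ih =>
      rw [Finset.sum_Ioc_succ_top (by omega)]
      have h : 1 / (((n + 2 + 1 : ℕ) : ℝ)) ^ 2 ≤ 1 / (n + 2 : ℝ) - 1 / (n + 3 : ℝ) := by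
        have h1 : 1 / (n + 2 : ℝ) - 1 / (n + 3 : ℝ) = 1 / ((n + 2) * (n + 3)) := by
          field_simp; ring
        rw [h1]
        push_cast
        apply one_div_le_one_div_of_le (by positivity)
        nlinarith
      have h2 : ((n + 1 : ℕ) : ℝ) + 2 = n + 3 := by push_cast; ring
      rw [show n + 1 + 2 = n + 2 + 1 from rfl] at *
      rw [h2]
      linarith
  rcases Nat.lt_or_ge Q 2 with h | h
  · rw [Finset.Ioc_eq_empty (by omega)]; norm_num
  · obtain ⟨n, rfl⟩ := Nat.exists_eq_add_of_le h
    have := key n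
    rw [add_comm 2 n]
    have : 0 ≤ 1 / (n + 2 : ℝ) := by positivity
    linarith [key n]

/-- A non-coprime pair has a common divisor `d ≥ 2`, and each `d` accounts for at most `(Q / d) ^ 2`
pairs, in total at most three quarters of all pairs. -/
theorem le_card_coprimePairs (Q : ℕ) : (Q : ℝ) ^ 2 / 4 ≤ (coprimePairs Q).card := by
  set D : ℕ → Finset ℕ := fun d => (Finset.Ioc 0 Q).filter fun a => d ∣ a
  have hD : ∀ d, (D d).card = Q / d := fun d => Nat.Ioc_filter_dvd_card_eq_div Q d
  have hsub : Finset.Ioc 0 Q ×ˢ Finset.Ioc 0 Q ⊆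
      coprimePairs Q ∪ (Finset.Ioc 1 Q).biUnion fun d => D d ×ˢ D d := by
    rintro ⟨a, b⟩ h
    simp only [Finset.mem_product, Finset.mem_Ioc] at h
    simp only [Finset.mem_union, mem_coprimePairs, Finset.mem_biUnion, Finset.mem_product, D,
      Finset.mem_filter, Finset.mem_Ioc]
    by_cases hc : a.Coprime b
    · left; exact ⟨h.1, h.2, hc⟩
    · right
      refine ⟨a.gcd b, ⟨?_, (Nat.le_of_dvd h.1.1 (Nat.gcd_dvd_left a b)).trans h.1.2⟩,
        ⟨h.1, Nat.gcd_dvd_left a b⟩, h.2, Nat.gcd_dvd_right a b⟩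
      have := Nat.gcd_pos_of_pos_left b h.1.1
      have : a.gcd b ≠ 1 := hc
      omega
  have h1 : Q * Q ≤ (coprimePairs Q).card + ∑ d ∈ Finset.Ioc 1 Q, (Q / d) * (Q / d) := by
    calc Q * Q = (Finset.Ioc 0 Q ×ˢ Finset.Ioc 0 Q).card := by simp
      _ ≤ _ := Finset.card_le_card hsub
      _ ≤ _ := Finset.card_union_le _ _
      _ ≤ _ := by
        gcongr
        refine Finset.card_biUnion_le.trans (le_of_eq ?_)
        simp [hD]
  have h2 : (∑ d ∈ Finset.Ioc 1 Q, ((Q / d : ℕ) : ℝ) * ((Q / d : ℕ) : ℝ)) ≤ 3 / 4 * (Q : ℝ) ^ 2 := by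
    calc _ ≤ ∑ d ∈ Finset.Ioc 1 Q, (1 / (d : ℝ) ^ 2) * (Q : ℝ) ^ 2 := by
          refine Finset.sum_le_sum fun d _ => ?_
          have h : ((Q / d : ℕ) : ℝ) ≤ Q / d := Nat.cast_div_le
          calc _ ≤ ((Q : ℝ) / d) * (Q / d) := by gcongr
            _ = _ := by rw [div_mul_div_comm]; ring
      _ = (∑ d ∈ Finset.Ioc 1 Q, 1 / (d : ℝ) ^ 2) * (Q : ℝ) ^ 2 := by rw [Finset.sum_mul]
      _ ≤ _ := by gcongr; exact sum_Ioc_one_div_sq_le Q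
  have h3 : (Q : ℝ) * Q ≤ (coprimePairs Q).card +
      ∑ d ∈ Finset.Ioc 1 Q, ((Q / d : ℕ) : ℝ) * ((Q / d : ℕ) : ℝ) := by exact_mod_cast h1
  nlinarith

/-- The fraction `a / (a + b)` attached to the pair `(a, b)`. -/
noncomputable def pairFraction (x : ℕ × ℕ) : ℝ := (x.1 : ℝ) / ((x.1 : ℝ) + x.2)

/-- The numerator `a * d - c * b` of the difference is an integer, nonzero by coprimality, and both
denominators are at most `2 * Q`. -/
theorem one_div_sq_le_abs_pairFraction_sub {Q : ℕ} {x y : ℕ × ℕ} (hx : x ∈ coprimePairs Q)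
    (hy : y ∈ coprimePairs Q) (hxy : x ≠ y) :
    1 / (2 * (Q : ℝ)) ^ 2 ≤ |pairFraction x - pairFraction y| := by
  obtain ⟨a, b⟩ := x
  obtain ⟨c, d⟩ := y
  simp only [mem_coprimePairs] at hx hy
  obtain ⟨⟨ha, haQ⟩, ⟨hb, hbQ⟩, hab⟩ := hx
  obtain ⟨⟨hc, hcQ⟩, ⟨hd, hdQ⟩, hcd⟩ := hy
  have hne : (a * d : ℤ) - c * b ≠ 0 := by
    intro h
    have h : a * d = c * b := by zify; linarith
    apply hxy
    have h1 : a ∣ c := hab.dvd_of_dvd_mul_right (Dvd.intro d h)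
    have h2 : c ∣ a := hcd.dvd_of_dvd_mul_right (Dvd.intro b h.symm)
    obtain rfl := Nat.dvd_antisymm h1 h2
    rw [Nat.eq_of_mul_eq_mul_left ha h]
  have h1 : (1 : ℝ) ≤ |(a * d : ℝ) - c * b| := by
    exact_mod_cast Int.one_le_abs hne
  have ha' : (0 : ℝ) < a := by exact_mod_cast ha
  have hb' : (0 : ℝ) < b := by exact_mod_cast hb
  have hc' : (0 : ℝ) < c := by exact_mod_cast hc
  have hd' : (0 : ℝ) < d := by exact_mod_cast hd
  have haQ' : (a : ℝ) ≤ Q := by exact_mod_cast haQ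
  have hbQ' : (b : ℝ) ≤ Q := by exact_mod_cast hbQ
  have hcQ' : (c : ℝ) ≤ Q := by exact_mod_cast hcQ
  have hdQ' : (d : ℝ) ≤ Q := by exact_mod_cast hdQ
  have h2 : pairFraction (a, b) - pairFraction (c, d) =
      ((a * d : ℝ) - c * b) / ((a + b) * (c + d)) := by
    simp only [pairFraction]
    field_simp
    ring
  rw [h2, abs_div, abs_of_pos (by positivity : (0 : ℝ) < (a + b) * (c + d))]
  apply div_le_div₀ (abs_nonneg _) h1 (by positivity)
  rw [sq]
  apply mul_le_mul <;> first | positivity | linarith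

/-- Pigeonhole: cells of length `σ` contain at most one point each. -/
theorem card_le_of_separated {ι : Type*} (s : Finset ι) (g : ι → ℝ) {σ u L : ℝ} (hσ : 0 < σ)
    (hL : 0 ≤ L) (hs : ∀ x ∈ s, ∀ y ∈ s, x ≠ y → σ ≤ |g x - g y|)
    (hg : ∀ x ∈ s, u ≤ g x ∧ g x ≤ u + L) : (s.card : ℝ) ≤ 1 + L / σ := by
  have h : s.card ≤ (Finset.range (⌊L / σ⌋₊ + 1)).card := by
    apply Finset.card_le_card_of_injOn (fun x => ⌊(g x - u) / σ⌋₊)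
    · intro x hx
      have := hg x hx
      simp only [Finset.coe_range, Set.mem_Iio]
      apply Nat.lt_succ_of_le
      apply Nat.floor_le_floor
      gcongr
      linarith
    · intro x hx y hy hxy
      by_contra hne
      have h1 := hs x hx y hy hne
      have hx0 : 0 ≤ (g x - u) / σ := div_nonneg (by linarith [hg x hx]) hσ.le
      have hy0 : 0 ≤ (g y - u) / σ := div_nonneg (by linarith [hg y hy]) hσ.le
      have e : ⌊(g x - u) / σ⌋₊ = ⌊(g y - u) / σ⌋₊ := hxy
      have a1 := Nat.floor_le hx0
      have a2 := Nat.lt_floor_add_one ((g x - u) / σ)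
      have b1 := Nat.floor_le hy0
      have b2 := Nat.lt_floor_add_one ((g y - u) / σ)
      rw [e] at a1 a2
      have h2 : |(g x - u) / σ - (g y - u) / σ| < 1 := abs_sub_lt_iff.mpr ⟨by linarith, by linarith⟩
      rw [← sub_div, abs_div, abs_of_pos hσ, div_lt_one hσ] at h2
      rw [sub_sub_sub_cancel_right] at h2
      linarith
  rw [Finset.card_range] at h
  calc (s.card : ℝ) ≤ ((⌊L / σ⌋₊ + 1 : ℕ) : ℝ) := by exact_mod_cast h
    _ ≤ _ := by
      push_cast
      linarith [Nat.floor_le (div_nonneg hL hσ.le)]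

/-! ### Second moment bound for the intervals to the right of the fractions. -/

/-- The second moment inequality for the measure of a finite union. -/
theorem sq_sum_measureReal_le {X ι : Type*} [MeasurableSpace X] {μ : Measure X} [IsFiniteMeasure μ]
    (s : Finset ι) {A : ι → Set X} {S : Set X} (hA : ∀ i ∈ s, MeasurableSet (A i))
    (hS : MeasurableSet S) (hAS : ∀ i ∈ s, A i ⊆ S) :
    (∑ i ∈ s, μ.real (A i)) ^ 2 ≤
      μ.real S * ∑ i ∈ s, ∑ j ∈ s, μ.real (A i ∩ A j) := by
  have int1 : ∀ {B : Set X}, MeasurableSet B → Integrable (B.indicator (1 : X → ℝ)) μ :=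
    fun hB => (integrable_const (1 : ℝ)).indicator hB
  -- This quadratic in `t` is the integral of `(∑ 1_{A i} - t 1_S) ^ 2`; its nonpositive
  -- discriminant is the claim.
  have key : ∀ t : ℝ, 0 ≤ μ.real S * (t * t) + (-(2 * ∑ i ∈ s, μ.real (A i))) * t +
      ∑ i ∈ s, ∑ j ∈ s, μ.real (A i ∩ A j) := by
    intro t
    have hpt : ∀ x, (∑ i ∈ s, (A i).indicator (1 : X → ℝ) x - t * S.indicator 1 x) ^ 2 =
        (∑ i ∈ s, ∑ j ∈ s, (A i ∩ A j).indicator (1 : X → ℝ) x)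
          - 2 * t * (∑ i ∈ s, (A i).indicator (1 : X → ℝ) x)
          + t * t * S.indicator (1 : X → ℝ) x := by
      intro x
      have h1 : ∑ i ∈ s, ∑ j ∈ s, (A i ∩ A j).indicator (1 : X → ℝ) x =
          (∑ i ∈ s, (A i).indicator (1 : X → ℝ) x) * ∑ i ∈ s, (A i).indicator (1 : X → ℝ) x := by
        rw [Finset.sum_mul_sum]
        refine Finset.sum_congr rfl fun i _ => Finset.sum_congr rfl fun j _ => ?_
        rw [Set.inter_indicator_one]; rfl
      have h2 : (∑ i ∈ s, (A i).indicator (1 : X → ℝ) x) * S.indicator 1 x =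
          ∑ i ∈ s, (A i).indicator (1 : X → ℝ) x := by
        rw [Finset.sum_mul]
        refine Finset.sum_congr rfl fun i hi => ?_
        by_cases hx : x ∈ A i
        · simp [hx, hAS i hi hx]
        · simp [hx]
      have h3 : S.indicator (1 : X → ℝ) x * S.indicator 1 x = S.indicator 1 x := by
        by_cases hx : x ∈ S <;> simp [hx]
      rw [h1]
      linear_combination (-2 * t) * h2 + t * t * h3
    have hint : ∫ x, (∑ i ∈ s, (A i).indicator (1 : X → ℝ) x - t * S.indicator 1 x) ^ 2 ∂μ =
        (∑ i ∈ s, ∑ j ∈ s, μ.real (A i ∩ A j)) - 2 * t * (∑ i ∈ s, μ.real (A i))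
          + t * t * μ.real S := by
      simp_rw [hpt]
      have i1 : Integrable (fun x => ∑ i ∈ s, ∑ j ∈ s, (A i ∩ A j).indicator (1 : X → ℝ) x) μ :=
        integrable_finsetSum _ fun i hi => integrable_finsetSum _ fun j hj =>
          int1 ((hA i hi).inter (hA j hj))
      have i2 : Integrable (fun x => ∑ i ∈ s, (A i).indicator (1 : X → ℝ) x) μ :=
        integrable_finsetSum _ fun i hi => int1 (hA i hi)
      have i3 : Integrable (fun x => (∑ i ∈ s, ∑ j ∈ s, (A i ∩ A j).indicator (1 : X → ℝ) x)
          - 2 * t * (∑ i ∈ s, (A i).indicator (1 : X → ℝ) x)) μ := i1.sub (i2.const_mul _)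
      rw [integral_add i3 ((int1 hS).const_mul _),
        integral_sub i1 (i2.const_mul _), integral_const_mul, integral_const_mul,
        integral_indicator_one hS, integral_finsetSum _ fun i hi => int1 (hA i hi),
        integral_finsetSum _ fun i hi => integrable_finsetSum _ fun j hj =>
          int1 ((hA i hi).inter (hA j hj))]
      congr 1
      congr 1
      · refine Finset.sum_congr rfl fun i hi => ?_
        rw [integral_finsetSum _ fun j hj => int1 ((hA i hi).inter (hA j hj))]
        refine Finset.sum_congr rfl fun j hj => ?_
        exact integral_indicator_one ((hA i hi).inter (hA j hj))
      · congr 1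
        exact Finset.sum_congr rfl fun i hi => integral_indicator_one (hA i hi)
    have h0 : 0 ≤ ∫ x, (∑ i ∈ s, (A i).indicator (1 : X → ℝ) x - t * S.indicator 1 x) ^ 2 ∂μ :=
      integral_nonneg fun x => sq_nonneg _
    rw [hint] at h0
    linarith
  have := discrim_le_zero key
  rw [discrim] at this
  nlinarith

/-- The length of the intervals attached to the fractions of level `k`. -/
noncomputable def gapLength (n k : ℕ) : ℝ := 1 / (n * (4 ^ (k + 1) * k))

/-- The points slightly larger than the fraction attached to `x`. -/
def upperGap (n k : ℕ) (x : ℕ × ℕ) : Set ℝ :=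
  Set.Ioo (pairFraction x) (pairFraction x + gapLength n k)

/-- The union of the intervals attached to the fractions of level `k`. -/
def upperGaps (n k : ℕ) : Set ℝ := ⋃ x ∈ coprimePairs (2 ^ k), upperGap n k x

theorem gapLength_nonneg (n k : ℕ) : 0 ≤ gapLength n k := by
  unfold gapLength; positivity

theorem gapLength_anti {m n : ℕ} (hm : 0 < m) (h : m ≤ n) (k : ℕ) :
    gapLength n k ≤ gapLength m k := by
  unfold gapLength
  rcases Nat.eq_zero_or_pos k with rfl | hk
  · simp
  · have : (m : ℝ) ≤ n := by exact_mod_cast h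
    gcongr

theorem gapLength_le {n k : ℕ} (hn : 0 < n) (hk : 0 < k) : gapLength n k ≤ 1 / 4 ^ (k + 1) := by
  unfold gapLength
  have hn' : (1 : ℝ) ≤ n := by exact_mod_cast hn
  have hk' : (1 : ℝ) ≤ k := by exact_mod_cast hk
  apply one_div_le_one_div_of_le (by positivity)
  calc (4 : ℝ) ^ (k + 1) = 1 * (4 ^ (k + 1) * 1) := by ring
    _ ≤ _ := by gcongr

theorem upperGap_subset_Ioo {n k : ℕ} (hn : 0 < n) (hk : 0 < k) {x : ℕ × ℕ}
    (hx : x ∈ coprimePairs (2 ^ k)) : upperGap n k x ⊆ Set.Ioo 0 1 := by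
  obtain ⟨a, b⟩ := x
  simp only [mem_coprimePairs] at hx
  obtain ⟨⟨ha, haQ⟩, ⟨hb, hbQ⟩, -⟩ := hx
  have ha' : (1 : ℝ) ≤ a := by exact_mod_cast ha
  have hb' : (1 : ℝ) ≤ b := by exact_mod_cast hb
  have haQ' : (a : ℝ) ≤ 2 ^ k := by exact_mod_cast haQ
  have hbQ' : (b : ℝ) ≤ 2 ^ k := by exact_mod_cast hbQ
  have h0 : 0 ≤ pairFraction (a, b) := by unfold pairFraction; positivity
  have h1 : pairFraction (a, b) + gapLength n k ≤ 1 := by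
    have h2 : gapLength n k ≤ 1 / ((a : ℝ) + b) := by
      refine (gapLength_le hn hk).trans (one_div_le_one_div_of_le (by positivity) ?_)
      have : (4 : ℝ) ^ (k + 1) = 2 ^ k * (2 * 2 ^ (k + 1)) := by
        rw [show (4 : ℝ) = 2 * 2 by norm_num, mul_pow]; ring
      have h3 : (1 : ℝ) ≤ 2 ^ (k + 1) := one_le_pow₀ (by norm_num)
      rw [this]
      nlinarith [pow_pos (two_pos : (0 : ℝ) < 2) k]
    have h3 : pairFraction (a, b) + 1 / ((a : ℝ) + b) ≤ 1 := by
      simp only [pairFraction]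
      rw [← add_div, div_le_one (by positivity)]
      linarith
    linarith
  exact Set.Ioo_subset_Ioo h0 h1

theorem measureReal_upperGap {n k : ℕ} (hn : 0 < n) (hk : 0 < k) {x : ℕ × ℕ}
    (hx : x ∈ coprimePairs (2 ^ k)) :
    (volume.restrict (Set.Ioo (0 : ℝ) 1)).real (upperGap n k x) = gapLength n k := by
  rw [measureReal_restrict_apply (by exact measurableSet_Ioo),
    Set.inter_eq_left.mpr (upperGap_subset_Ioo hn hk hx), upperGap, Real.volume_real_Ioo]
  simp [gapLength_nonneg]

/-- Fix `x`. An interval of level `l` meeting that of `x` starts in a window of length `gapLength n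
k + gapLength n l`; separation bounds the number of such intervals, and each overlap is at most
`gapLength n l`. -/
theorem sum_measureReal_upperGap_inter_le {n k l : ℕ} (hn : 0 < n) (hk : 0 < k) (hkl : k ≤ l) :
    ∑ x ∈ coprimePairs (2 ^ k), ∑ y ∈ coprimePairs (2 ^ l),
      (volume.restrict (Set.Ioo (0 : ℝ) 1)).real (upperGap n k x ∩ upperGap n l y) ≤
    4 ^ k * (gapLength n l * (1 + (gapLength n k + gapLength n l) * 4 ^ (l + 1))) := by
  classical
  have hl : 0 < l := hk.trans_le hkl
  have hkn := gapLength_nonneg n k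
  have hln := gapLength_nonneg n l
  have inner : ∀ x ∈ coprimePairs (2 ^ k), ∑ y ∈ coprimePairs (2 ^ l),
      (volume.restrict (Set.Ioo (0 : ℝ) 1)).real (upperGap n k x ∩ upperGap n l y) ≤
      gapLength n l * (1 + (gapLength n k + gapLength n l) * 4 ^ (l + 1)) := by
    intro x _
    set F := (coprimePairs (2 ^ l)).filter fun y => (upperGap n k x ∩ upperGap n l y).Nonempty
    have h1 : ∑ y ∈ coprimePairs (2 ^ l),
        (volume.restrict (Set.Ioo (0 : ℝ) 1)).real (upperGap n k x ∩ upperGap n l y) ≤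
        ∑ y ∈ F, gapLength n l := by
      rw [Finset.sum_filter]
      refine Finset.sum_le_sum fun y hy => ?_
      split_ifs with h
      · rw [← measureReal_upperGap hn hl hy]
        exact measureReal_mono Set.inter_subset_right
      · rw [Set.not_nonempty_iff_eq_empty.mp h]; simp
    have h2 : (F.card : ℝ) ≤ 1 + (gapLength n k + gapLength n l) / (1 / (2 * ((2 ^ l : ℕ) : ℝ)) ^ 2) := by
      apply card_le_of_separated F pairFraction (u := pairFraction x - gapLength n l)
        (by positivity) (by positivity)
      · intro y hy z hz hyz
        exact one_div_sq_le_abs_pairFraction_sub (Finset.mem_filter.mp hy).1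
          (Finset.mem_filter.mp hz).1 hyz
      · intro y hy
        obtain ⟨t, ⟨h1, h2⟩, h3, h4⟩ := (Finset.mem_filter.mp hy).2
        constructor <;> linarith
    have h3 : (1 / (2 * ((2 ^ l : ℕ) : ℝ)) ^ 2) = 1 / 4 ^ (l + 1) := by
      push_cast
      rw [show (4 : ℝ) = 2 ^ 2 by norm_num, ← pow_mul, mul_comm 2 (l + 1), pow_mul]
      ring
    rw [h3, div_div_eq_mul_div, div_one] at h2
    refine h1.trans ?_
    rw [Finset.sum_const, nsmul_eq_mul, mul_comm]
    gcongr
  refine (Finset.sum_le_sum inner).trans ?_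
  rw [Finset.sum_const, nsmul_eq_mul]
  gcongr
  have := card_coprimePairs_le (2 ^ k)
  calc ((coprimePairs (2 ^ k)).card : ℝ) ≤ (((2 ^ k) ^ 2 : ℕ) : ℝ) := by exact_mod_cast this
    _ = _ := by push_cast; rw [← pow_mul, mul_comm, pow_mul]; norm_num

/-- The near-diagonal weight in the bound for pair correlations. -/
noncomputable def diagonalWeight (k l : ℕ) : ℝ := if k ≤ l then (1 / 4) ^ (l - k) / l else 0

theorem diagonalWeight_nonneg (k l : ℕ) : 0 ≤ diagonalWeight k l := by
  unfold diagonalWeight; split_ifs <;> positivity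

theorem sum_measureReal_upperGap_inter_le_of_le {n k l : ℕ} (hn : 0 < n) (hk : 0 < k)
    (hkl : k ≤ l) :
    ∑ x ∈ coprimePairs (2 ^ k), ∑ y ∈ coprimePairs (2 ^ l),
      (volume.restrict (Set.Ioo (0 : ℝ) 1)).real (upperGap n k x ∩ upperGap n l y) ≤
    1 / (2 * n) * diagonalWeight k l + 1 / (4 * n ^ 2) * ((1 / k) * (1 / l)) := by
  refine (sum_measureReal_upperGap_inter_le hn hk hkl).trans ?_
  obtain ⟨d, rfl⟩ := Nat.exists_eq_add_of_le hkl
  have hn' : (1 : ℝ) ≤ n := by exact_mod_cast hn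
  have hk' : (1 : ℝ) ≤ k := by exact_mod_cast hk
  have hl' : (1 : ℝ) ≤ ((k + d : ℕ) : ℝ) := by exact_mod_cast hk.trans_le hkl
  simp only [diagonalWeight, if_pos hkl, gapLength, Nat.add_sub_cancel_left]
  generalize ((k + d : ℕ) : ℝ) = l at *
  have e : (4 : ℝ) ^ k * (1 / (n * (4 ^ (k + d + 1) * l)) *
      (1 + (1 / (n * (4 ^ (k + 1) * k)) + 1 / (n * (4 ^ (k + d + 1) * l))) * 4 ^ (k + d + 1))) =
      1 / (4 * n) * ((1 / 4) ^ d / l) + 1 / (4 * n) * ((1 / 4) ^ d / l) * (1 / (n * l))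
        + 1 / (4 * n ^ 2) * ((1 / k) * (1 / l)) := by
    simp only [pow_add, one_div, inv_pow]
    field_simp
    ring
  rw [e]
  -- The middle summand of `e` is absorbed into the first one, which doubles `1 / (4 * n)` to `1 /
  -- (2 * n)`.
  have h1 : 1 / (n * l) ≤ 1 := by
    rw [div_le_one (by positivity)]
    nlinarith
  have h2 : 1 / (4 * n) * ((1 / 4) ^ d / l) * (1 / (n * l)) ≤ 1 / (4 * n) * ((1 / 4) ^ d / l) :=
    mul_le_of_le_one_right (by positivity) h1
  have h3 : 1 / (2 * (n : ℝ)) = 1 / (4 * n) + 1 / (4 * n) := by field_simp; norm_num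
  rw [h3]
  linarith

theorem sum_measureReal_upperGap_inter_le_add {n k l : ℕ} (hn : 0 < n) (hk : 0 < k) (hl : 0 < l) :
    ∑ x ∈ coprimePairs (2 ^ k), ∑ y ∈ coprimePairs (2 ^ l),
      (volume.restrict (Set.Ioo (0 : ℝ) 1)).real (upperGap n k x ∩ upperGap n l y) ≤
    1 / (2 * n) * (diagonalWeight k l + diagonalWeight l k) +
      1 / (4 * n ^ 2) * ((1 / k) * (1 / l)) := by
  have h1 := diagonalWeight_nonneg k l
  have h2 := diagonalWeight_nonneg l k
  rcases le_total k l with h | h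
  · refine (sum_measureReal_upperGap_inter_le_of_le hn hk h).trans ?_
    gcongr
    linarith
  · rw [Finset.sum_comm]
    simp_rw [Set.inter_comm (upperGap n k _)]
    refine (sum_measureReal_upperGap_inter_le_of_le hn hl h).trans ?_
    rw [mul_comm (1 / (l : ℝ))]
    gcongr
    linarith

theorem sum_diagonalWeight_le (m K : ℕ) :
    ∑ l ∈ Finset.Icc m K, ∑ k ∈ Finset.Icc m K, diagonalWeight k l ≤
      2 * ∑ l ∈ Finset.Icc m K, 1 / (l : ℝ) := by
  rw [Finset.mul_sum]
  refine Finset.sum_le_sum fun l hl => ?_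
  have h1 : ∑ k ∈ Finset.Icc m K, diagonalWeight k l ≤
      ∑ k ∈ Finset.range (l + 1), (1 / 4 : ℝ) ^ (l - k) / l := by
    simp only [diagonalWeight]
    rw [← Finset.sum_filter]
    apply Finset.sum_le_sum_of_subset_of_nonneg
    · intro k hk
      simp only [Finset.mem_filter, Finset.mem_Icc, Finset.mem_range] at hk ⊢
      omega
    · intros; positivity
  refine h1.trans ?_
  have h2 : ∑ k ∈ Finset.range (l + 1), (1 / 4 : ℝ) ^ (l - k) ≤ 2 := by
    have h3 := Finset.sum_range_reflect (fun i => (1 / 4 : ℝ) ^ i) (l + 1)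
    simp only [Nat.add_sub_cancel] at h3
    rw [h3]
    refine le_trans (Finset.sum_le_sum fun i _ => ?_) (sum_geometric_two_le (l + 1))
    gcongr
    norm_num
  rw [← Finset.sum_div, mul_one_div]
  gcongr

theorem measurableSet_upperGap (n k : ℕ) (x : ℕ × ℕ) : MeasurableSet (upperGap n k x) :=
  measurableSet_Ioo

theorem measurableSet_upperGaps (n k : ℕ) : MeasurableSet (upperGaps n k) :=
  Finset.measurableSet_biUnion _ fun x _ => measurableSet_upperGap n k x

theorem upperGaps_anti {m n : ℕ} (hm : 0 < m) (h : m ≤ n) (k : ℕ) :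
    upperGaps n k ⊆ upperGaps m k := by
  refine Set.biUnion_mono subset_rfl fun x _ => Set.Ioo_subset_Ioo le_rfl ?_
  linarith [gapLength_anti hm h k]

theorem exists_le_sum_Icc_one_div (m : ℕ) (C : ℝ) :
    ∃ K, C ≤ ∑ k ∈ Finset.Icc m K, 1 / (k : ℝ) := by
  have h := Real.tendsto_sum_range_one_div_nat_succ_atTop
  obtain ⟨K, hK⟩ := (h.eventually_ge_atTop (C + ∑ k ∈ Finset.range m, 1 / (k : ℝ))).exists
  refine ⟨K, ?_⟩
  have h1 : ∑ i ∈ Finset.range K, (1 / (i + 1) : ℝ) ≤ ∑ i ∈ Finset.range (K + 1), 1 / (i : ℝ) := by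
    rw [Finset.sum_range_succ']
    simp
  have h2 : ∑ i ∈ Finset.range (K + 1), 1 / (i : ℝ) ≤
      ∑ k ∈ Finset.range m, 1 / (k : ℝ) + ∑ k ∈ Finset.Icc m K, 1 / (k : ℝ) := by
    rw [← Finset.sum_union]
    · apply Finset.sum_le_sum_of_subset_of_nonneg
      · intro i hi
        simp only [Finset.mem_union, Finset.mem_range, Finset.mem_Icc] at hi ⊢
        omega
      · intros; positivity
    · rw [Finset.disjoint_left]
      intro i hi
      simp only [Finset.mem_range, Finset.mem_Icc] at hi ⊢
      omega
  linarith

/-- With `t = H / n`, the first moment is at least `t / 16` and the second at most `2 * t + t ^ 2 /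
4`. The latter is at most `t ^ 2` once `t ≥ 8 / 3`, whence the constant `(1 / 16) ^ 2`. -/
theorem le_measureReal_iUnion_upperGaps {n m : ℕ} (hn : 0 < n) (hm : 0 < m) :
    1 / 256 ≤ (volume.restrict (Set.Ioo (0 : ℝ) 1)).real (⋃ k ≥ m, upperGaps n k) := by
  set μ := volume.restrict (Set.Ioo (0 : ℝ) 1)
  set S := ⋃ k ≥ m, upperGaps n k
  have hn' : (0 : ℝ) < n := by exact_mod_cast hn
  obtain ⟨K, hK⟩ := exists_le_sum_Icc_one_div m (8 / 3 * n)
  set H := ∑ k ∈ Finset.Icc m K, 1 / (k : ℝ) with hH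
  have hH0 : 0 < H := lt_of_lt_of_le (by positivity) hK
  set s : Finset (Σ _ : ℕ, ℕ × ℕ) := (Finset.Icc m K).sigma fun k => coprimePairs (2 ^ k)
  set A : (Σ _ : ℕ, ℕ × ℕ) → Set ℝ := fun i => upperGap n i.1 i.2
  have hA : ∀ i ∈ s, MeasurableSet (A i) := fun i _ => measurableSet_upperGap n i.1 i.2
  have hS : MeasurableSet S :=
    MeasurableSet.iUnion fun k => MeasurableSet.iUnion fun _ => measurableSet_upperGaps n k
  have hAS : ∀ i ∈ s, A i ⊆ S := by
    rintro ⟨k, x⟩ hi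
    rw [Finset.mem_sigma, Finset.mem_Icc] at hi
    exact (Set.subset_biUnion_of_mem (u := fun x => upperGap n k x) hi.2).trans
      (Set.subset_biUnion_of_mem (u := fun k => upperGaps n k) (s := {k | k ≥ m}) hi.1.1)
  have hpos : ∀ k ∈ Finset.Icc m K, 0 < k := fun k hk => hm.trans_le (Finset.mem_Icc.mp hk).1
  have first : H / (16 * n) ≤ ∑ i ∈ s, μ.real (A i) := by
    rw [Finset.sum_sigma, hH, Finset.sum_div]
    refine Finset.sum_le_sum fun k hk => ?_
    have hk0 : (0 : ℝ) < k := by exact_mod_cast hpos k hk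
    rw [Finset.sum_congr rfl fun x hx => measureReal_upperGap hn (hpos k hk) hx, Finset.sum_const,
      nsmul_eq_mul]
    calc 1 / (k : ℝ) / (16 * n) = ((2 ^ k : ℕ) : ℝ) ^ 2 / 4 * gapLength n k := by
          have : ((2 ^ k : ℕ) : ℝ) ^ 2 = 4 ^ k := by
            push_cast; rw [← pow_mul, mul_comm, pow_mul]; norm_num
          rw [this, gapLength, pow_succ]
          field_simp
          norm_num
      _ ≤ _ := by
        gcongr
        · exact gapLength_nonneg n k
        · exact le_card_coprimePairs _
  have second : ∑ i ∈ s, ∑ j ∈ s, μ.real (A i ∩ A j) ≤ 2 * H / n + H ^ 2 / (4 * n ^ 2) := by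
    have e : ∑ i ∈ s, ∑ j ∈ s, μ.real (A i ∩ A j) = ∑ k ∈ Finset.Icc m K, ∑ l ∈ Finset.Icc m K,
        ∑ x ∈ coprimePairs (2 ^ k), ∑ y ∈ coprimePairs (2 ^ l),
          μ.real (upperGap n k x ∩ upperGap n l y) := by
      simp only [s, Finset.sum_sigma]
      refine Finset.sum_congr rfl fun k _ => ?_
      rw [Finset.sum_comm]
    rw [e]
    calc _ ≤ ∑ k ∈ Finset.Icc m K, ∑ l ∈ Finset.Icc m K,
          (1 / (2 * n) * (diagonalWeight k l + diagonalWeight l k) +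
            1 / (4 * n ^ 2) * ((1 / (k : ℝ)) * (1 / l))) :=
          Finset.sum_le_sum fun k hk => Finset.sum_le_sum fun l hl =>
            sum_measureReal_upperGap_inter_le_add hn (hpos k hk) (hpos l hl)
      _ = 1 / (2 * n) * (2 * ∑ l ∈ Finset.Icc m K, ∑ k ∈ Finset.Icc m K, diagonalWeight k l) +
            1 / (4 * n ^ 2) * (H * H) := by
          rw [hH, Finset.sum_mul_sum]
          simp only [Finset.sum_add_distrib, ← Finset.mul_sum]
          rw [Finset.sum_comm (f := fun k l => diagonalWeight k l)]
          ring
      _ ≤ 1 / (2 * n) * (2 * (2 * H)) + 1 / (4 * n ^ 2) * (H * H) := by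
          gcongr
          exact sum_diagonalWeight_le m K
      _ = _ := by field_simp
  have main := sq_sum_measureReal_le (μ := μ) s hA hS hAS
  set t := H / n with ht
  have ht0 : 8 / 3 ≤ t := by rw [ht, le_div_iff₀ hn']; exact hK
  have e1 : H / (16 * n) = t / 16 := by rw [ht]; field_simp
  have e2 : 2 * H / n + H ^ 2 / (4 * n ^ 2) = 2 * t + t ^ 2 / 4 := by rw [ht]; field_simp
  rw [e1] at first
  rw [e2] at second
  have h1 : (t / 16) ^ 2 ≤ μ.real S * t ^ 2 := by
    calc (t / 16) ^ 2 ≤ (∑ i ∈ s, μ.real (A i)) ^ 2 := by gcongr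
      _ ≤ _ := main
      _ ≤ μ.real S * t ^ 2 := by
        gcongr
        refine second.trans ?_
        nlinarith
  have h2 : 0 < t ^ 2 := by positivity
  by_contra! hlt
  nlinarith

/-! ### The one-sided approximation set and its zero-one law. -/

/-- The numbers with infinitely many rational approximations from below that are better than the
divergence threshold of Khinchin's theorem by any constant factor. -/
def lowerKhinchinSet : Set ℝ :=
  {α | ∀ n : ℕ, 0 < n → ∃ k : ℕ, n ≤ k ∧ ∃ p : ℤ, ∃ q : ℕ, 0 < q ∧ q ≤ 2 ^ (k + 1) ∧
    0 < (q : ℝ) * α - p ∧ (q : ℝ) * α - p < 1 / (n * (2 ^ k * k))}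

theorem iInter_iUnion_upperGaps_subset :
    ⋂ n : ℕ, ⋃ k ≥ n + 1, upperGaps (n + 1) k ⊆ lowerKhinchinSet := by
  intro α hα n hn
  obtain ⟨n, rfl⟩ := Nat.exists_eq_succ_of_ne_zero hn.ne'
  have h := Set.mem_iInter.mp hα n
  simp only [upperGaps, Set.mem_iUnion, exists_prop] at h
  obtain ⟨k, hk, ⟨a, b⟩, hx, h1, h2⟩ := h
  simp only [mem_coprimePairs] at hx
  obtain ⟨⟨ha, haQ⟩, ⟨hb, hbQ⟩, -⟩ := hx
  refine ⟨k, hk, a, a + b, by omega, by rw [pow_succ]; omega, ?_⟩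
  have ha' : (0 : ℝ) < a := by exact_mod_cast ha
  have hb' : (0 : ℝ) < b := by exact_mod_cast hb
  have haQ' : (a : ℝ) ≤ 2 ^ k := by exact_mod_cast haQ
  have hbQ' : (b : ℝ) ≤ 2 ^ k := by exact_mod_cast hbQ
  have hk' : (0 : ℝ) < k := by exact_mod_cast (by omega : 0 < k)
  have hs : (0 : ℝ) < a + b := by positivity
  have e : ((a + b : ℕ) : ℝ) * α - ((a : ℤ) : ℝ) = (a + b) * (α - pairFraction (a, b)) := by
    simp only [pairFraction]
    push_cast
    field_simp
  rw [e]
  refine ⟨mul_pos hs (by linarith), ?_⟩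
  have h3 : α - pairFraction (a, b) < gapLength (n + 1) k := by linarith
  calc ((a : ℝ) + b) * (α - pairFraction (a, b)) < (a + b) * gapLength (n + 1) k := by gcongr
    _ ≤ (2 ^ (k + 2)) * gapLength (n + 1) k := by
      gcongr
      · exact gapLength_nonneg _ _
      · rw [pow_add]; nlinarith [pow_pos (two_pos : (0 : ℝ) < 2) k]
    _ = _ := by
      rw [gapLength]
      rw [show (4 : ℝ) = 2 * 2 by norm_num, mul_pow, pow_add, pow_succ]
      push_cast
      field_simp
      ring

theorem measurableSet_lowerKhinchinSet : MeasurableSet lowerKhinchinSet := by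
  unfold lowerKhinchinSet
  refine measurableSet_setOfPred.mpr ?_
  refine Measurable.forall fun n => Measurable.imp measurable_const ?_
  refine Measurable.exists fun k => Measurable.and measurable_const ?_
  refine Measurable.exists fun p => Measurable.exists fun q => Measurable.and measurable_const ?_
  refine Measurable.and measurable_const (Measurable.and ?_ ?_)
  · exact measurableSet_setOfPred.mp (measurableSet_lt measurable_const (by fun_prop))
  · exact measurableSet_setOfPred.mp (measurableSet_lt (by fun_prop) measurable_const)

theorem volume_restrict_lowerKhinchinSet_ne_zero :
    (volume.restrict (Set.Ioc (0 : ℝ) 1)) lowerKhinchinSet ≠ 0 := by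
  set μ := volume.restrict (Set.Ioo (0 : ℝ) 1)
  have hanti : Antitone fun n : ℕ => ⋃ k ≥ n + 1, upperGaps (n + 1) k := by
    intro m n hmn α hα
    simp only [Set.mem_iUnion, exists_prop] at hα ⊢
    obtain ⟨k, hk, h⟩ := hα
    exact ⟨k, by omega, upperGaps_anti (by omega) (by omega) k h⟩
  have hlim := tendsto_measure_iInter_atTop (μ := μ)
    (fun n => (MeasurableSet.iUnion fun k => MeasurableSet.iUnion fun _ =>
      measurableSet_upperGaps (n + 1) k).nullMeasurableSet) hanti ⟨0, measure_ne_top _ _⟩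
  have hge : ENNReal.ofReal (1 / 256) ≤ μ (⋂ n : ℕ, ⋃ k ≥ n + 1, upperGaps (n + 1) k) := by
    refine ge_of_tendsto' hlim fun n => ?_
    exact (ENNReal.ofReal_le_iff_le_toReal (measure_ne_top _ _)).mpr
      (le_measureReal_iUnion_upperGaps n.succ_pos n.succ_pos)
  have h : 0 < (volume.restrict (Set.Ioc (0 : ℝ) 1)) lowerKhinchinSet := by
    calc (0 : ENNReal) < ENNReal.ofReal (1 / 256) := by simp
      _ ≤ _ := hge
      _ ≤ μ lowerKhinchinSet := measure_mono iInter_iUnion_upperGaps_subset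
      _ ≤ _ := Measure.restrict_mono Set.Ioo_subset_Ioc_self le_rfl _
  exact h.ne'

theorem add_intCast_mem_lowerKhinchinSet {α : ℝ} (h : α ∈ lowerKhinchinSet) (z : ℤ) :
    α + z ∈ lowerKhinchinSet := by
  intro n hn
  obtain ⟨k, hk, p, q, hq, hqk, h1, h2⟩ := h n hn
  refine ⟨k, hk, p + q * z, q, hq, hqk, ?_⟩
  have e : (q : ℝ) * (α + z) - ((p + q * z : ℤ) : ℝ) = q * α - p := by push_cast; ring
  rw [e]
  exact ⟨h1, h2⟩

/-- Doubling costs a factor `2` in the error, which is absorbed by using the approximation for `2 *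
n`; this is why the set asks for every constant `n`. -/
theorem two_mul_mem_lowerKhinchinSet {α : ℝ} (h : α ∈ lowerKhinchinSet) :
    2 * α ∈ lowerKhinchinSet := by
  intro n hn
  obtain ⟨k, hk, p, q, hq, hqk, h1, h2⟩ := h (2 * n) (by omega)
  refine ⟨k, by omega, 2 * p, q, hq, hqk, ?_⟩
  have e : (q : ℝ) * (2 * α) - ((2 * p : ℤ) : ℝ) = 2 * (q * α - p) := by push_cast; ring
  rw [e]
  refine ⟨by linarith, ?_⟩
  have e2 : 1 / ((n : ℝ) * (2 ^ k * k)) = 2 * (1 / ((2 * n : ℕ) * (2 ^ k * k))) := by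
    push_cast
    simp only [one_div, mul_inv]
    ring
  rw [e2]
  linarith

/-- By invariance under integer translations the set descends to a subset `W` of the circle that the
doubling map sends into itself. Ergodicity makes `W` null or conull, and the second moment bound
excludes null. -/
theorem ae_mem_lowerKhinchinSet :
    ∀ᵐ α ∂(volume.restrict (Set.Ioo (0 : ℝ) 1)), α ∈ lowerKhinchinSet := by
  set W : Set UnitAddCircle := {θ | ((AddCircle.equivIco 1 0 θ : Set.Ico (0 : ℝ) (0 + 1)) : ℝ) ∈ lowerKhinchinSet}
  have hWm : MeasurableSet W :=
    (measurable_subtype_coe.comp (AddCircle.measurableEquivIco 1 0).measurable)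
      measurableSet_lowerKhinchinSet
  have hW : ∀ α : ℝ, (α : UnitAddCircle) ∈ W ↔ α ∈ lowerKhinchinSet := by
    intro α
    have e : ((AddCircle.equivIco 1 0 (α : UnitAddCircle) : Set.Ico (0 : ℝ) (0 + 1)) : ℝ) =
        Int.fract α := by
      simp [AddCircle.coe_equivIco_mk_apply]
    simp only [W, Set.mem_ofPred_eq, e]
    constructor
    · intro h
      simpa using add_intCast_mem_lowerKhinchinSet h ⌊α⌋
    · intro h
      have := add_intCast_mem_lowerKhinchinSet h (-⌊α⌋)
      rwa [Int.cast_neg, ← sub_eq_add_neg, Int.self_sub_floor] at this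
  have hsub : W ⊆ (fun y : UnitAddCircle => 2 • y) ⁻¹' W := by
    intro θ hθ
    obtain ⟨α, rfl⟩ := QuotientAddGroup.mk_surjective θ
    have h2 := two_mul_mem_lowerKhinchinSet ((hW α).mp hθ)
    have e : (2 : ℕ) • (α : UnitAddCircle) = ((2 * α : ℝ) : UnitAddCircle) := by
      rw [← AddCircle.coe_nsmul, nsmul_eq_mul]; norm_num
    show (2 : ℕ) • (α : UnitAddCircle) ∈ W
    rw [e]
    exact (hW _).mpr h2
  have hmp := AddCircle.measurePreserving_mk (1 : ℝ) 0
  rw [zero_add] at hmp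
  have hpre : ((↑) : ℝ → UnitAddCircle) ⁻¹' W = lowerKhinchinSet := Set.ext hW
  rcases (AddCircle.ergodic_nsmul (T := 1) one_lt_two).ae_empty_or_univ_of_ae_le_preimage
    hWm.nullMeasurableSet hsub.eventuallyLE with h | h
  · exfalso
    apply volume_restrict_lowerKhinchinSet_ne_zero
    rw [← hpre, hmp.measure_preimage hWm.nullMeasurableSet]
    exact ae_eq_empty.mp h
  · have h1 : ∀ᵐ θ : UnitAddCircle, θ ∈ W := eventuallyEq_univ.mp h
    have h2 := hmp.quasiMeasurePreserving.ae h1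
    have h3 : ∀ᵐ α ∂(volume.restrict (Set.Ioc (0 : ℝ) 1)), α ∈ lowerKhinchinSet :=
      h2.mono fun α hα => (hW α).mp hα
    exact ae_mono (Measure.restrict_mono Set.Ioo_subset_Ioc_self le_rfl) h3

/-! ### Trimmed sums and orbits of the rotation. -/

section TrimmedSum

variable {X : Type*} {T : X → X} {f : X → ℝ} {N : ℕ} {x : X}

theorem trimmedSum_one_le_sum_erase {i : ℕ} (hi : i < N) :
    trimmedSum T f N 1 x ≤ ∑ n ∈ (Finset.range N).erase i, f (T^[n] x) := by
  have hi' : i ∈ Finset.range N := Finset.mem_range.mpr hi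
  rw [trimmedSum, dif_pos (by omega), ← Finset.sum_erase_add _ _ hi']
  have hmem : {i} ∈ (Finset.range N).powersetCard 1 := by
    rw [Finset.mem_powersetCard]
    exact ⟨Finset.singleton_subset_iff.mpr hi', Finset.card_singleton i⟩
  have := Finset.le_sup' (fun s => ∑ j ∈ s, f (T^[j] x)) hmem
  simp only [Finset.sum_singleton] at this
  linarith

/-- Whichever index is removed, one of `i` and `j` survives, and the other terms are nonnegative. -/
theorem le_trimmedSum_one {i j : ℕ} {m : ℝ} (hf : ∀ n, 0 ≤ f (T^[n] x)) (hij : i ≠ j)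
    (hi : i < N) (hj : j < N) (him : m ≤ f (T^[i] x)) (hjm : m ≤ f (T^[j] x)) :
    m ≤ trimmedSum T f N 1 x := by
  have h1 : 1 ≤ N := by omega
  have hne : ((Finset.range N).powersetCard 1).Nonempty :=
    Finset.powersetCard_nonempty.mpr (by simpa using h1)
  rw [trimmedSum, dif_pos h1]
  obtain ⟨s, hs, he⟩ := Finset.exists_mem_eq_sup' hne (fun s => ∑ j ∈ s, f (T^[j] x))
  rw [he]
  obtain ⟨hsN, hs1⟩ := Finset.mem_powersetCard.mp hs
  obtain ⟨l, rfl⟩ := Finset.card_eq_one.mp hs1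
  have hl : l ∈ Finset.range N := hsN (Finset.mem_singleton_self l)
  rw [← Finset.sum_erase_add _ _ hl, Finset.sum_singleton, add_sub_cancel_right]
  have key : ∀ k, k < N → k ≠ l → f (T^[k] x) ≤ ∑ n ∈ (Finset.range N).erase l, f (T^[n] x) :=
    fun k hk hkl => Finset.single_le_sum (f := fun n => f (T^[n] x)) (fun n _ => hf n)
      (Finset.mem_erase.mpr ⟨hkl, Finset.mem_range.mpr hk⟩)
  by_cases h : i = l
  · exact hjm.trans (key j hj (by omega))
  · exact him.trans (key i hi h)

end TrimmedSum

theorem circleRotation_iterate {α x : ℝ} (hx : Int.fract x = x) (n : ℕ) :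
    (circleRotation α)^[n] x = Int.fract (x + n * α) := by
  induction n with
  | zero => simp [hx]
  | succ n ih =>
    rw [Function.iterate_succ_apply', ih, circleRotation]
    push_cast
    rw [show x + (n + 1 : ℝ) * α = x + n * α + α by ring, Int.fract_eq_fract]
    exact ⟨-⌊x + n * α⌋, by rw [Int.fract]; push_cast; ring⟩

/-- The values `e = 0` and `e = 1` encode the starting points `0` and `α`, so both cases are treated
at once. -/
theorem circleRotation_iterate_natCast_mul {α : ℝ} (hα : α ∈ Set.Ioo (0 : ℝ) 1) {e : ℕ}
    (he : e ≤ 1) (n : ℕ) :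
    (circleRotation α)^[n] (e * α) = Int.fract (((n + e : ℕ) : ℝ) * α) := by
  rw [circleRotation_iterate]
  · congr 1; push_cast; ring
  · rw [Int.fract_eq_self]
    interval_cases e
    · simp
    · simpa using ⟨hα.1.le, hα.2⟩

theorem reciprocalObservable_nonneg {x : ℝ} (hx : 0 ≤ x) : 0 ≤ reciprocalObservable x := by
  unfold reciprocalObservable
  split_ifs <;> positivity

theorem reciprocalObservable_of_pos {x : ℝ} (hx : 0 < x) : reciprocalObservable x = 1 / x :=
  if_neg hx.ne'

/-! ### The upper limit. -/

theorem exists_two_le_lightlyTrimmedRatio {α : ℝ} (hα : α ∈ Set.Ioo (0 : ℝ) 1)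
    (hW : α ∈ lowerKhinchinSet) {e : ℕ} (he : e ≤ 1) (M : ℕ) :
    ∃ N ≥ M, 2 ≤ lightlyTrimmedRatio α (e * α) N := by
  -- The constant `128` gives `1 / (2 * δ) ≥ 64 * 2 ^ k * k`, while `N log N ≤ 32 * 2 ^ k * k` for
  -- `N = 2 ^ (k + 3)`, which exceeds `2 * q`.
  obtain ⟨k, hk, p, q, hq, hqk, h1, h2⟩ := hW (M + 128) (by omega)
  have hpow : k < 2 ^ k := Nat.lt_two_pow_self
  have hN : 2 * q < 2 ^ (k + 3) := by
    calc 2 * q ≤ 2 * 2 ^ (k + 1) := by omega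
      _ < _ := by rw [pow_add, pow_add]; omega
  refine ⟨2 ^ (k + 3), by rw [pow_add]; omega, ?_⟩
  set δ := (q : ℝ) * α - p with hδ
  have hk1 : (1 : ℝ) ≤ k := by exact_mod_cast (by omega : 1 ≤ k)
  have hB : (1 : ℝ) ≤ 2 ^ k * k := by
    have : (1 : ℝ) ≤ 2 ^ k := one_le_pow₀ (by norm_num)
    nlinarith
  have hδB : δ * (128 * (2 ^ k * k)) ≤ 1 := by
    have hpos : (0 : ℝ) < ((M + 128 : ℕ) : ℝ) * (2 ^ k * k) := by positivity
    have h3 : δ * (((M + 128 : ℕ) : ℝ) * (2 ^ k * k)) < 1 := (lt_div_iff₀ hpos).mp h2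
    have h4 : (128 : ℝ) ≤ ((M + 128 : ℕ) : ℝ) := by push_cast; linarith [Nat.cast_nonneg (α := ℝ) M]
    have h5 : δ * (128 * (2 ^ k * k)) ≤ δ * (((M + 128 : ℕ) : ℝ) * (2 ^ k * k)) := by gcongr
    linarith
  have hδ1 : δ < 1 / 2 := by nlinarith
  have f1 : Int.fract ((q : ℝ) * α) = δ :=
    Int.fract_eq_iff.mpr ⟨h1.le, by linarith, p, by rw [hδ]; ring⟩
  have f2 : Int.fract (((2 * q : ℕ) : ℝ) * α) = 2 * δ :=
    Int.fract_eq_iff.mpr ⟨by linarith, by linarith, 2 * p, by rw [hδ]; push_cast; ring⟩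
  have hlow : 1 / (2 * δ) ≤ trimmedSum (circleRotation α) reciprocalObservable (2 ^ (k + 3)) 1 (e * α) := by
    apply le_trimmedSum_one (i := q - e) (j := 2 * q - e) _ (by omega) (by omega) (by omega)
    · rw [circleRotation_iterate_natCast_mul hα he, Nat.sub_add_cancel (by omega), f1,
        reciprocalObservable_of_pos h1]
      exact one_div_le_one_div_of_le h1 (by linarith)
    · rw [circleRotation_iterate_natCast_mul hα he, Nat.sub_add_cancel (by omega), f2,
        reciprocalObservable_of_pos (by linarith)]
    · intro n
      rw [circleRotation_iterate_natCast_mul hα he]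
      exact reciprocalObservable_nonneg (Int.fract_nonneg _)
  have hlow2 : 64 * (2 ^ k * k) ≤ 1 / (2 * δ) := by
    rw [le_div_iff₀ (by linarith)]
    linarith
  have hlog : Real.log ((2 ^ (k + 3) : ℕ) : ℝ) ≤ 4 * k := by
    push_cast
    rw [Real.log_pow]
    push_cast
    have := Real.log_two_lt_d9
    have : Real.log 2 ≤ 1 := by linarith
    nlinarith
  have hlogpos : 0 < Real.log ((2 ^ (k + 3) : ℕ) : ℝ) :=
    Real.log_pos (by exact_mod_cast Nat.one_lt_two_pow (by omega))
  rw [lightlyTrimmedRatio, le_div_iff₀ (by positivity)]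
  calc 2 * (((2 ^ (k + 3) : ℕ) : ℝ) * Real.log ((2 ^ (k + 3) : ℕ) : ℝ))
      ≤ 2 * (((2 ^ (k + 3) : ℕ) : ℝ) * (4 * k)) := by gcongr
    _ = 64 * (2 ^ k * k) := by push_cast; ring
    _ ≤ _ := hlow2.trans hlow

/-! ### The lower limit. -/

theorem exists_rat_lt_sub_lt {α : ℝ} (hirr : Irrational α) (hW : α ∈ lowerKhinchinSet) (M : ℕ) :
    ∃ r : ℚ, M < r.den ∧ 0 < α - r ∧ α - r < 1 / (r.den : ℝ) ^ 2 := by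
  set F : ℝ := Int.fract ((M.factorial : ℝ) * α)
  have hM : (0 : ℝ) < M.factorial := by exact_mod_cast M.factorial_pos
  have hF : 0 < F := Int.fract_pos.mpr
    ((hirr.natCast_mul M.factorial_ne_zero).ne_int _)
  obtain ⟨n, hn⟩ := exists_nat_gt (M.factorial / F)
  obtain ⟨k, hk, p, q, hq, hqk, h1, h2⟩ := hW (n + 2) (by omega)
  have hq' : (0 : ℝ) < q := by exact_mod_cast hq
  have hq1 : (1 : ℝ) ≤ q := by exact_mod_cast hq
  have hk1 : (1 : ℝ) ≤ k := by exact_mod_cast (by omega : 1 ≤ k)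
  have h2k : (1 : ℝ) ≤ 2 ^ k := one_le_pow₀ (by norm_num)
  set r : ℚ := (p : ℚ) / (q : ℚ) with hr
  have hcast : (r : ℝ) = p / q := by rw [hr]; push_cast; rfl
  have e : α - r = (q * α - p) / q := by rw [hcast]; field_simp
  have hden : r.den ∣ q := by
    have := Rat.den_dvd p q
    rw [Rat.divInt_eq_div, Int.cast_natCast] at this
    exact Int.natCast_dvd_natCast.mp this
  have hdenq : (r.den : ℝ) ≤ q := by exact_mod_cast Nat.le_of_dvd hq hden
  have hden0 : (0 : ℝ) < r.den := by exact_mod_cast r.den_pos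
  have hpos : 0 < α - r := by rw [e]; positivity
  have hlt : ((q : ℝ) * α - p) * ((n + 2) * (2 ^ k * k)) < 1 := by
    rw [lt_div_iff₀ (by positivity)] at h2
    push_cast at h2
    exact h2
  have hB : (1 : ℝ) ≤ 2 ^ k * k := by nlinarith
  refine ⟨r, ?_, hpos, ?_⟩
  -- A denominator at most `M` divides `M!`, so `M! * r` is an integer below `M! * α` and `M! * (α -
  -- r) ≥ F`. The choice of `n` makes `α - r` too small for this.
  · by_contra! hle
    obtain ⟨d, hd⟩ := Nat.dvd_factorial r.den_pos hle
    have hint : (M.factorial : ℝ) * r = ((d * r.num : ℤ) : ℝ) := by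
      rw [hd, Rat.cast_def]
      push_cast
      field_simp
    have hfl : d * r.num ≤ ⌊(M.factorial : ℝ) * α⌋ := by
      rw [Int.le_floor, ← hint]
      gcongr
      linarith
    have hfr : F ≤ M.factorial * (α - r) := by
      rw [mul_sub, hint]
      have : ((d * r.num : ℤ) : ℝ) ≤ (⌊(M.factorial : ℝ) * α⌋ : ℝ) := by exact_mod_cast hfl
      have h3 : F = M.factorial * α - ⌊(M.factorial : ℝ) * α⌋ := rfl
      linarith
    have h4 : (α - r) * n ≤ 1 := by
      have h5 : α - r ≤ q * α - p := by rw [e]; exact div_le_self h1.le hq1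
      have h6 : (n : ℝ) ≤ (n + 2) * (2 ^ k * k) := by
        nlinarith [Nat.cast_nonneg (α := ℝ) n]
      have : (α - r) * n ≤ (q * α - p) * ((n + 2) * (2 ^ k * k)) := by gcongr
      linarith
    rw [div_lt_iff₀ hF] at hn
    have h7 : n * F ≤ M.factorial * ((α - r) * n) := by nlinarith [Nat.cast_nonneg (α := ℝ) n]
    nlinarith
  · have h3 : α - r < 1 / (q : ℝ) ^ 2 := by
      rw [e, lt_div_iff₀ (by positivity), sq, ← mul_assoc, div_mul_cancel₀ _ hq'.ne']
      have hqk' : (q : ℝ) ≤ 2 ^ k * 2 := by exact_mod_cast (by rw [← pow_succ]; exact hqk)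
      have h6 : (q : ℝ) ≤ (n + 2) * (2 ^ k * k) := by
        have : (2 : ℝ) ≤ n + 2 := by linarith [Nat.cast_nonneg (α := ℝ) n]
        calc (q : ℝ) ≤ 2 * (2 ^ k * 1) := by linarith
          _ ≤ _ := by gcongr
      calc ((q : ℝ) * α - p) * q ≤ ((q : ℝ) * α - p) * ((n + 2) * (2 ^ k * k)) := by gcongr
        _ < 1 := hlt
    refine h3.trans_le (one_div_le_one_div_of_le (by positivity) ?_)
    gcongr

/-- The residues `ρ j` of `j * r.num` modulo `q` permute `1, …, q - 1`. Approximation from below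
moves each point to the right of `ρ j / q`, away from the singularity at `0`, by less than `1 / q`,
so it never wraps around. The sum is thus dominated by `q` times a harmonic sum. -/
theorem sum_one_div_fract_le {α : ℝ} {r : ℚ} (h1 : 0 < α - r) (h2 : α - r < 1 / (r.den : ℝ) ^ 2) :
    ∑ j ∈ Finset.Ico 1 r.den, 1 / Int.fract ((j : ℝ) * α) ≤
      r.den * (1 + Real.log r.den) := by
  set q := r.den with hq
  have hq0 : 0 < q := r.den_pos
  have hqr : (0 : ℝ) < q := by exact_mod_cast hq0
  set ρ : ℕ → ℕ := fun j => ((j * r.num) % q).toNat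
  have hρ : ∀ j, (ρ j : ℤ) = (j * r.num) % q := fun j =>
    Int.toNat_of_nonneg (Int.emod_nonneg _ (by omega))
  have hcop : IsCoprime (q : ℤ) r.num := by
    rw [Int.isCoprime_iff_nat_coprime]
    simpa using r.reduced.symm
  have hmaps : ∀ j ∈ Finset.Ico 1 q, ρ j ∈ Finset.Ico 1 q := by
    intro j hj
    rw [Finset.mem_Ico] at hj ⊢
    have hlt : (ρ j : ℤ) < q := by rw [hρ]; exact Int.emod_lt_of_pos _ (by omega)
    refine ⟨?_, by exact_mod_cast hlt⟩
    by_contra! h0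
    have h0 : (j * r.num) % (q : ℤ) = 0 := by rw [← hρ]; omega
    have hdvd : (q : ℤ) ∣ j := hcop.dvd_of_dvd_mul_right (Int.dvd_of_emod_eq_zero h0)
    have := Nat.le_of_dvd (by omega) (Int.natCast_dvd_natCast.mp hdvd)
    omega
  have hinj : Set.InjOn ρ (Finset.Ico 1 q : Finset ℕ) := by
    intro i hi j hj hij
    simp only [Finset.coe_Ico, Set.mem_Ico] at hi hj
    have h0 : (i * r.num) % (q : ℤ) = (j * r.num) % q := by rw [← hρ, ← hρ, hij]
    have hdvd : (q : ℤ) ∣ (j - i) * r.num := by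
      rw [sub_mul]; exact Int.ModEq.dvd h0
    have hdvd2 : (q : ℤ) ∣ j - i := hcop.dvd_of_dvd_mul_right hdvd
    have := Int.eq_zero_of_abs_lt_dvd hdvd2 (by rw [abs_lt]; omega)
    omega
  have himage : (Finset.Ico 1 q).image ρ = Finset.Ico 1 q :=
    Finset.eq_of_subset_of_card_le (Finset.image_subset_iff.mpr hmaps)
      (Finset.card_image_of_injOn hinj).ge
  have hterm : ∀ j ∈ Finset.Ico 1 q, 1 / Int.fract ((j : ℝ) * α) ≤ q * (ρ j : ℝ)⁻¹ := by
    intro j hj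
    have hρj := Finset.mem_Ico.mp (hmaps j hj)
    rw [Finset.mem_Ico] at hj
    have hρ1 : (1 : ℝ) ≤ ρ j := by exact_mod_cast hρj.1
    have hρq : (ρ j : ℝ) + 1 ≤ q := by exact_mod_cast hρj.2
    have hj0 : (0 : ℝ) < j := by exact_mod_cast hj.1
    have hjq : (j : ℝ) ≤ q := by exact_mod_cast hj.2.le
    have hsmall : j * (α - r) < 1 / q := by
      calc j * (α - r) ≤ q * (α - r) := by gcongr
        _ < q * (1 / (q : ℝ) ^ 2) := by gcongr
        _ = 1 / q := by field_simp
    have hfr : Int.fract ((j : ℝ) * α) = ρ j / q + j * (α - r) := by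
      have hup : (ρ j : ℝ) / q + 1 / q ≤ 1 := by
        rw [← add_div, div_le_one hqr]; exact hρq
      refine Int.fract_eq_iff.mpr ⟨by positivity, by linarith, (j * r.num) / q, ?_⟩
      have h3 : (ρ j : ℝ) + q * (((j * r.num) / (q : ℤ) : ℤ) : ℝ) = j * r.num := by
        have := Int.emod_add_mul_ediv (j * r.num) q
        rw [← hρ] at this
        exact_mod_cast this
      have h4 : (r : ℝ) = r.num / q := by rw [hq]; exact Rat.cast_def r
      rw [h4]
      field_simp
      linarith
    have hle : (ρ j : ℝ) / q ≤ Int.fract ((j : ℝ) * α) := by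
      rw [hfr]
      have : 0 < j * (α - r) := by positivity
      linarith
    calc 1 / Int.fract ((j : ℝ) * α) ≤ 1 / ((ρ j : ℝ) / q) :=
          one_div_le_one_div_of_le (by positivity) hle
      _ = _ := by rw [one_div_div, div_eq_mul_inv]
  have hharm : ∑ i ∈ Finset.Icc 1 q, ((i : ℝ))⁻¹ ≤ 1 + Real.log q := by
    have := harmonic_le_one_add_log q
    rw [harmonic_eq_sum_Icc] at this
    push_cast at this
    exact this
  calc _ ≤ ∑ j ∈ Finset.Ico 1 q, q * (ρ j : ℝ)⁻¹ := Finset.sum_le_sum hterm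
    _ = q * ∑ i ∈ Finset.Ico 1 q, (i : ℝ)⁻¹ := by
      rw [← Finset.mul_sum, ← Finset.sum_image (f := fun i : ℕ => (i : ℝ)⁻¹) hinj, himage]
    _ ≤ q * ∑ i ∈ Finset.Icc 1 q, (i : ℝ)⁻¹ := by
      gcongr
      exact Finset.Ico_subset_Icc_self
    _ ≤ _ := by gcongr

theorem trimmedSum_den_le {α : ℝ} (hα : α ∈ Set.Ioo (0 : ℝ) 1) (hirr : Irrational α) {e : ℕ}
    (he : e ≤ 1) {r : ℚ} (h1 : 0 < α - r) (h2 : α - r < 1 / (r.den : ℝ) ^ 2) :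
    trimmedSum (circleRotation α) reciprocalObservable r.den 1 (e * α) ≤
      r.den * (1 + Real.log r.den) := by
  have hq : 0 < r.den := r.den_pos
  -- The erased index is `0` for `x = 0`, where the observable vanishes by convention, and `q - 1`
  -- for `x = α`, which is the multiple `q * α`. Either way the multiples `j * α` with `0 < j < q`
  -- remain.
  have hi : e * (r.den - 1) < r.den := by interval_cases e <;> omega
  refine (trimmedSum_one_le_sum_erase hi).trans (le_trans (le_of_eq ?_)
    (sum_one_div_fract_le h1 h2))
  refine Finset.sum_nbij (· + e) ?_ ?_ ?_ ?_
  · intro n hn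
    simp only [Finset.mem_erase, Finset.mem_range, Finset.mem_Ico] at hn ⊢
    interval_cases e <;> omega
  · intro m _ n _ h
    simpa using h
  · intro j hj
    simp only [Finset.coe_Ico, Set.mem_Ico] at hj
    refine ⟨j - e, ?_, by simp only; omega⟩
    simp only [Finset.coe_erase, Finset.coe_range, Set.mem_sdiff, Set.mem_Iio,
      Set.mem_singleton_iff]
    interval_cases e <;> omega
  · intro n hn
    have hne : n + e ≠ 0 := by
      simp only [Finset.mem_erase, Finset.mem_range] at hn
      interval_cases e <;> omega
    rw [circleRotation_iterate_natCast_mul hα he, reciprocalObservable_of_pos]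
    exact Int.fract_pos.mpr ((hirr.natCast_mul hne).ne_int _)

theorem exists_lightlyTrimmedRatio_lt {α : ℝ} (hα : α ∈ Set.Ioo (0 : ℝ) 1) (hirr : Irrational α)
    (hW : α ∈ lowerKhinchinSet) {e : ℕ} (he : e ≤ 1) {c : ℝ} (hc : 1 < c) (M : ℕ) :
    ∃ N ≥ M, lightlyTrimmedRatio α (e * α) N < c := by
  have hlog := Real.tendsto_log_atTop.comp tendsto_natCast_atTop_atTop
  obtain ⟨M', hM'⟩ := eventually_atTop.mp (hlog.eventually_gt_atTop (1 / (c - 1)))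
  obtain ⟨r, hr, h1, h2⟩ := exists_rat_lt_sub_lt hirr hW (max M M')
  -- This is exactly `1 + log q < c * log q`.
  have hl : 1 / (c - 1) < Real.log r.den := hM' r.den ((le_max_right M M').trans hr.le)
  have hl0 : 0 < Real.log r.den := lt_trans (by apply one_div_pos.mpr; linarith) hl
  have hq : (0 : ℝ) < r.den := by exact_mod_cast r.den_pos
  refine ⟨r.den, (le_max_left M M').trans hr.le, ?_⟩
  rw [lightlyTrimmedRatio, div_lt_iff₀ (by positivity)]
  refine (trimmedSum_den_le hα hirr he h1 h2).trans_lt ?_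
  rw [div_lt_iff₀ (by linarith)] at hl
  nlinarith

theorem limsup_liminf_lightlyTrimmedRatio {α : ℝ} (hα : α ∈ Set.Ioo (0 : ℝ) 1)
    (hirr : Irrational α) (hW : α ∈ lowerKhinchinSet) {e : ℕ} (he : e ≤ 1) :
    (1 : EReal) < limsup (fun N : ℕ => ((lightlyTrimmedRatio α (e * α) N : ℝ) : EReal)) atTop ∧
      liminf (fun N : ℕ => ((lightlyTrimmedRatio α (e * α) N : ℝ) : EReal)) atTop ≤ (1 : EReal) := by
  constructor
  · have h : ((2 : ℝ) : EReal) ≤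
        limsup (fun N : ℕ => ((lightlyTrimmedRatio α (e * α) N : ℝ) : EReal)) atTop := by
      refine le_limsup_of_frequently_le ?_
      rw [frequently_atTop]
      intro M
      obtain ⟨N, hN, h⟩ := exists_two_le_lightlyTrimmedRatio hα hW he M
      exact ⟨N, hN, EReal.coe_le_coe_iff.mpr h⟩
    refine lt_of_lt_of_le ?_ h
    exact_mod_cast (one_lt_two : (1 : ℝ) < 2)
  · by_contra! hlt
    obtain ⟨c, hc1, hc2⟩ := EReal.lt_iff_exists_real_btwn.mp hlt
    have hev := eventually_lt_of_lt_liminf hc2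
    obtain ⟨M, hM⟩ := eventually_atTop.mp hev
    obtain ⟨N, hN, h⟩ := exists_lightlyTrimmedRatio_lt hα hirr hW he
      (by exact_mod_cast hc1 : (1 : ℝ) < c) M
    exact absurd (EReal.coe_lt_coe_iff.mp (hM N hN)) h.le.not_gt

/-! ### Almost every `α`. -/

theorem ae_irrational (s : Set ℝ) : ∀ᵐ α ∂(volume.restrict s), Irrational α :=
  ae_restrict_of_ae ((Set.countable_range ((↑) : ℚ → ℝ)).ae_notMem volume)

theorem mainTheorem5 :
    ∀ᵐ α ∂(MeasureTheory.volume.restrict (Set.Ioo (0 : ℝ) 1)),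
      ∀ x ∈ ({α, 0} : Set ℝ),
        (1 : EReal) < Filter.limsup
            (fun N : ℕ => ((lightlyTrimmedRatio α x N : ℝ) : EReal)) Filter.atTop ∧
        Filter.liminf
            (fun N : ℕ => ((lightlyTrimmedRatio α x N : ℝ) : EReal)) Filter.atTop ≤ (1 : EReal) ∧
        ∀ L : EReal, ¬ Filter.Tendsto
            (fun N : ℕ => ((lightlyTrimmedRatio α x N : ℝ) : EReal)) Filter.atTop (nhds L) := by
  filter_upwards [ae_mem_lowerKhinchinSet, ae_irrational (Set.Ioo 0 1),
    ae_restrict_mem measurableSet_Ioo] with α hW hirr hα x hx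
  have key : (1 : EReal) < limsup (fun N : ℕ => ((lightlyTrimmedRatio α x N : ℝ) : EReal)) atTop ∧
      liminf (fun N : ℕ => ((lightlyTrimmedRatio α x N : ℝ) : EReal)) atTop ≤ (1 : EReal) := by
    rcases hx with rfl | rfl
    · simpa using limsup_liminf_lightlyTrimmedRatio hα hirr hW le_rfl
    · simpa using limsup_liminf_lightlyTrimmedRatio hα hirr hW zero_le_one
  refine ⟨key.1, key.2, fun L hL => ?_⟩
  rw [hL.limsup_eq, hL.liminf_eq] at key
  exact absurd key.1 key.2.not_gt
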